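/- Let $n>m\ge 1$ be integers, let $[n]=\{1,\dots,n\}$ be a library of items, and let $p_1\ge p_2\ge\cdots\ge p_n>0$ with $\sum_{i=1}^n p_i=1$. The states of a cache of size $m$ are the vectors $x=(x_1,\dots,x_m)$ of distinct items of $[n]$. Items are requested one after the other, independently, item $i$ with probability $p_i$, and the cache follows the policy CLIMB: if the requested item is in position $j\ge 2$, it is exchanged with the item in position $j-1$; if it is in position $1$, nothing changes; if it is not in the cache, it replaces the item in the last position $m$. Let $P$ be the one-request transition matrix of the resulting Markov chain on the cache states. Then $P$ has a unique stationary distribution $\pi^*$, and the mixing time $$t_{\mathrm{mix}}^{\mathrm{CLIMB}}=\min\Big\{t\in\{0,1,2,\dots\}:\ \max_{x}\big\|P^t(x,\cdot)-\pi^*\big\|_{TV}\le \tfrac12\Big\},\qquad \|\mu-\nu\|_{TV}=\tfrac12\sum_y|\mu(y)-\nu(y)|,$$ exists and satisfies $$t_{\mathrm{mix}}^{\mathrm{CLIMB}}=O\left(\frac{n^{2m}\left(\prod_{i=1}^m p_i^{m-i+1}\right)^6}{p_n^2\left(\prod_{i=n-m+1}^n p_i^{i-n+m}\right)^6}\,\ln\left(\frac{n^m\prod_{i=1}^m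 p_i^{m-i+1}}{\prod_{i=n-m+1}^n p_i^{i-n+m}}\right)\right),$$ where the implied constant is absolute, that is, independent of $n$, $m$ and $p_1,\dots,p_n$. -/

import Mathlib

/-- The states of a cache of size `m` for a library of `n` items: vectors `(x₁, …, x_m)` of
distinct items.  Index `0` is the first (top) position, index `m - 1` the last one. -/
abbrev CacheState (n m : ℕ) : Type := Fin m ↪ Fin n

namespace CacheState

/-- CLIMB, cache hit in position `j`: the item moves up one position, i.e. it is exchanged with the
item in the position just above it.  A hit in the first position changes nothing (for `j = 0` the
truncated predecessor is `j` itself, and `Equiv.swap j j` is the identity). -/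
def climbHit {n m : ℕ} (x : CacheState n m) (j : Fin m) : CacheState n m :=
  (Equiv.swap (⟨j.val - 1, lt_of_le_of_lt (Nat.sub_le _ _) j.isLt⟩ : Fin m) j).toEmbedding.trans x

/-- CLIMB, cache miss on item `i`: the item in the last position is evicted and replaced by `i`. -/
def climbMiss {n m : ℕ} (x : CacheState n m) (i : Fin n) (hi : i ∉ Set.range x) :
    CacheState n m where
  toFun k := if k.val + 1 = m then i else x k
  inj' := by
    intro a b hab
    by_cases ha : a.val + 1 = m <;> by_cases hb : b.val + 1 = m
    · exact Fin.ext (by omega)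
    · simp only [ha, hb, if_true, if_false] at hab
      exact absurd ⟨b, hab.symm⟩ hi
    · simp only [ha, hb, if_true, if_false] at hab
      exact absurd ⟨a, hab⟩ hi
    · simp only [ha, hb, if_false] at hab
      exact x.injective hab

/-- The new state of a CLIMB cache in state `x` after a request for item `i`. -/
def climbStep {n m : ℕ} (x : CacheState n m) (i : Fin n) : CacheState n m :=
  if hi : i ∈ Set.range x then x.climbHit (x.invOfMemRange ⟨i, hi⟩) else x.climbMiss i hi

end CacheState

/-- The one-request transition matrix of CLIMB when the requests are independent and item `i` is
requested with probability `p i`. -/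
def climbMatrix {n : ℕ} (m : ℕ) (p : Fin n → ℝ) :
    Matrix (CacheState n m) (CacheState n m) ℝ :=
  fun x y => ∑ i : Fin n, if x.climbStep i = y then p i else 0

section MarkovChain

/-- `π` is a stationary probability distribution of the transition matrix `P`. -/
def IsStationaryDist {S : Type*} [Fintype S] (P : Matrix S S ℝ) (π : S → ℝ) : Prop :=
  (∀ x, 0 ≤ π x) ∧ ∑ x, π x = 1 ∧ Matrix.vecMul π P = π

/-- Total variation distance of two probability distributions on a finite set. -/
noncomputable def tvDist {S : Type*} [Fintype S] (μ ν : S → ℝ) : ℝ :=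
  (1 / 2) * ∑ x, |μ x - ν x|

/-- `t` is the mixing time with tolerance `ε` of the chain `P` with stationary distribution `π`:
the smallest `t` such that, from every initial state, the law of the chain after `t` steps is
within total variation distance `ε` of `π`. -/
def IsMixingTime {S : Type*} [Fintype S] [DecidableEq S] (P : Matrix S S ℝ) (π : S → ℝ) (ε : ℝ)
    (t : ℕ) : Prop :=
  IsLeast {s : ℕ | ∀ x, tvDist ((P ^ s) x) π ≤ ε} t

end MarkovChain

/-- `∏_{i=1}^{m} p_i ^ (m - i + 1)`; the 1-based index is `i = k + 1`. -/
def climbTopWeight {n m : ℕ} (hmn : m < n) (p : Fin n → ℝ) : ℝ :=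
  ∏ k : Fin m, p ⟨k.val, by omega⟩ ^ (m - k.val)

/-- `∏_{i=n-m+1}^{n} p_i ^ (i - n + m)`; the 1-based index is `i = n - m + k + 1`. -/
def climbBottomWeight {n m : ℕ} (hmn : m < n) (p : Fin n → ℝ) : ℝ :=
  ∏ k : Fin m, p ⟨n - m + k.val, by omega⟩ ^ (k.val + 1)

/-! CLIMB is reversible with respect to the weight `∏ k, p (x k) ^ (m - k)`: every request is undone
by exactly one request, and the two probabilities stand in the inverse ratio of the weights
(`weight_mul_climbMatrix`). By rearrangement every weight lies between `B = climbBottomWeight` and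
`T = climbTopWeight`, so with at most `n ^ m` states all stationary probabilities are at least `b =
B / (n ^ m * T)`. Allowed moves, and holding by a request for the top item, have probability at
least `a = p_n`.

For a reversible chain, simple paths give a Poincaré inequality (`poincare`). The holding
probability turns the Dirichlet form into a loss of second moment in each step
(`holding_mul_dirichlet_le`), so periodicity needs no spectral argument. Hence mean-zero functions
contract by `1 - γ` in mean square, `γ = a ^ 2 * b / |S|`. Applied to the density of the law minus
one, this gives uniqueness and mixing within about `log (1 / b) / γ` steps, where `1 / γ ≤ n ^ (2 *
m) * (T / B) / a ^ 2`. -/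

/-! ### Mixing of reversible chains with holding. -/

section ReversibleChains

variable {S : Type*} [Fintype S]

/-- Along a path, the squared increment of a function is at most the number of vertices times
the sum of the squared increments over all edges of the graph. -/
theorem SimpleGraph.Connected.sq_sub_le_card_mul_sum [DecidableEq S] {G : SimpleGraph S}
    [DecidableRel G.Adj] (hG : G.Connected) (f : S → ℝ) (u v : S) :
    (f u - f v) ^ 2 ≤
      Fintype.card S * ∑ x, ∑ y, if G.Adj x y then (f x - f y) ^ 2 else 0 := by
  have telescope : ∀ {a b : S} (q : G.Walk a b),
      (q.darts.map fun d => f d.fst - f d.snd).sum = f a - f b := by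
    intro a b q
    induction q with
    | nil => simp
    | cons h q ih => simp [ih]
  obtain ⟨q, hq⟩ := (hG.preconnected u v).exists_isPath
  have hnd : q.darts.Nodup := SimpleGraph.Walk.darts_nodup_of_support_nodup hq.support_nodup
  have hsum : ∑ d ∈ q.darts.toFinset, (f d.fst - f d.snd) = f u - f v := by
    rw [List.sum_toFinset _ hnd, telescope q]
  have hcard : (q.darts.toFinset.card : ℝ) ≤ Fintype.card S := by
    rw [List.toFinset_card_of_nodup hnd, SimpleGraph.Walk.length_darts]
    exact_mod_cast hq.length_lt.le
  -- A simple path uses each directed edge at most once, so its edges form a subset of all edges.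
  have hle : ∑ d ∈ q.darts.toFinset, (f d.fst - f d.snd) ^ 2 ≤
      ∑ x, ∑ y, if G.Adj x y then (f x - f y) ^ 2 else 0 := by
    rw [← Fintype.sum_prod_type' (f := fun x y => if G.Adj x y then (f x - f y) ^ 2 else 0),
      ← Finset.sum_filter]
    rw [← Finset.sum_image (s := q.darts.toFinset) (g := fun d : G.Dart => d.toProd)
      (f := fun z : S × S => (f z.1 - f z.2) ^ 2)
      (fun a _ b _ h => SimpleGraph.Dart.ext _ _ h)]
    refine Finset.sum_le_sum_of_subset_of_nonneg ?_ fun _ _ _ => sq_nonneg _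
    intro z hz
    obtain ⟨d, -, rfl⟩ := Finset.mem_image.1 hz
    simp [d.adj]
  calc (f u - f v) ^ 2 = (∑ d ∈ q.darts.toFinset, (f d.fst - f d.snd)) ^ 2 := by rw [hsum]
    _ ≤ q.darts.toFinset.card * ∑ d ∈ q.darts.toFinset, (f d.fst - f d.snd) ^ 2 :=
        sq_sum_le_card_mul_sum_sq
    _ ≤ _ := mul_le_mul hcard hle (Finset.sum_nonneg fun _ _ => sq_nonneg _) (Nat.cast_nonneg _)

/-- The variance of `f` under a probability vector `μ` is at least `μ x` times the second moment
of `f - f x`. -/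
theorem mul_sum_sq_sub_le_variance {μ : S → ℝ} (hμ : ∀ y, 0 ≤ μ y) (hμ1 : ∑ y, μ y = 1)
    (f : S → ℝ) (x : S) :
    μ x * ∑ y, μ y * (f y - f x) ^ 2 ≤ ∑ y, μ y * f y ^ 2 - (∑ y, μ y * f y) ^ 2 := by
  classical
  set A := ∑ y, μ y * (f y - f x) ^ 2 with hA
  set B := ∑ y, μ y * (f y - f x) with hB
  have h1 : ∑ y, μ y * f y = B + f x := by
    simp only [hB, mul_sub, Finset.sum_sub_distrib, ← Finset.sum_mul, hμ1]; ring
  have h2 : ∑ y, μ y * f y ^ 2 = A + 2 * f x * B + f x ^ 2 := by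
    have : ∀ y, μ y * f y ^ 2 =
        μ y * (f y - f x) ^ 2 + 2 * f x * (μ y * (f y - f x)) + μ y * f x ^ 2 := by
      intro y; ring
    simp only [this, Finset.sum_add_distrib, ← Finset.mul_sum, ← Finset.sum_mul, hμ1, ← hA, ← hB]
    ring
  -- The term at `x` vanishes; leaving it out gives Cauchy–Schwarz the total mass `1 - μ x` instead
  -- of `1`.
  have hA' : A = ∑ y ∈ Finset.univ.erase x, μ y * (f y - f x) ^ 2 := by
    rw [hA, ← Finset.add_sum_erase _ _ (Finset.mem_univ x)]; simp
  have hB' : B = ∑ y ∈ Finset.univ.erase x, μ y * (f y - f x) := by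
    rw [hB, ← Finset.add_sum_erase _ _ (Finset.mem_univ x)]; simp
  have hm : ∑ y ∈ Finset.univ.erase x, μ y = 1 - μ x := by
    rw [← hμ1, ← Finset.add_sum_erase _ _ (Finset.mem_univ x)]; ring
  have hcs : B ^ 2 ≤ (1 - μ x) * A := by
    rw [hA', hB', ← hm]
    exact Finset.sum_sq_le_sum_mul_sum_of_sq_le_mul _ (fun y _ => hμ y)
      (fun y _ => mul_nonneg (hμ y) (sq_nonneg _)) (fun y _ => le_of_eq (by ring))
  rw [h1, h2]
  nlinarith

/-- A reversible transition matrix `P` with positive reversing probability distribution `π`. -/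
structure IsReversibleChain (P : Matrix S S ℝ) (π : S → ℝ) : Prop where
  nonneg : ∀ x y, 0 ≤ P x y
  row_sum : ∀ x, ∑ y, P x y = 1
  pos : ∀ x, 0 < π x
  sum_eq_one : ∑ x, π x = 1
  balance : ∀ x y, π x * P x y = π y * P y x

namespace IsReversibleChain

variable {P : Matrix S S ℝ} {π : S → ℝ}

theorem isStationaryDist (h : IsReversibleChain P π) : IsStationaryDist P π := by
  refine ⟨fun x => (h.pos x).le, h.sum_eq_one, ?_⟩
  ext y
  simp only [Matrix.vecMul, dotProduct, h.balance _ y, ← Finset.mul_sum, h.row_sum, mul_one]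

theorem sum_mul_mulVec (h : IsReversibleChain P π) (f : S → ℝ) :
    ∑ x, π x * ∑ y, P x y * f y = ∑ x, π x * f x := by
  simp only [Finset.mul_sum]
  rw [Finset.sum_comm]
  refine Finset.sum_congr rfl fun y _ => ?_
  have : ∀ x, π x * (P x y * f y) = P y x * (π y * f y) := by
    intro x; rw [← mul_assoc, h.balance]; ring
  simp only [this, ← Finset.sum_mul, h.row_sum, one_mul]

/-- The one-step decrease of the second moment dominates the Dirichlet form. -/
theorem holding_mul_dirichlet_le (h : IsReversibleChain P π) {a : ℝ} (ha : ∀ x, a ≤ P x x)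
    (f : S → ℝ) :
    a * ∑ x, ∑ y, π x * P x y * (f x - f y) ^ 2 ≤
      ∑ x, π x * f x ^ 2 - ∑ x, π x * (P.mulVec f x) ^ 2 := by
  rw [← h.sum_mul_mulVec (fun x => f x ^ 2), ← Finset.sum_sub_distrib, Finset.mul_sum]
  refine Finset.sum_le_sum fun x _ => ?_
  have hx := mul_sum_sq_sub_le_variance (h.nonneg x) (h.row_sum x) f x
  have hD : 0 ≤ ∑ y, P x y * (f y - f x) ^ 2 :=
    Finset.sum_nonneg fun y _ => mul_nonneg (h.nonneg x y) (sq_nonneg _)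
  have hE : ∑ y, π x * P x y * (f x - f y) ^ 2 = π x * ∑ y, P x y * (f y - f x) ^ 2 := by
    rw [Finset.mul_sum]; exact Finset.sum_congr rfl fun y _ => by ring
  rw [hE, ← mul_sub]
  calc _ = π x * (a * ∑ y, P x y * (f y - f x) ^ 2) := by ring
    _ ≤ _ := mul_le_mul_of_nonneg_left ((mul_le_mul_of_nonneg_right (ha x) hD).trans hx)
      (h.pos x).le

/-- A Poincaré inequality from simple paths. -/
theorem poincare [DecidableEq S] (h : IsReversibleChain P π) {G : SimpleGraph S}
    (hG : G.Connected) {a b : ℝ} (ha : 0 ≤ a) (hb : 0 ≤ b)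
    (haP : ∀ x y, G.Adj x y → a ≤ P x y) (hbπ : ∀ x, b ≤ π x) {f : S → ℝ}
    (hf : ∑ x, π x * f x = 0) :
    a * b * ∑ x, π x * f x ^ 2 ≤
      Fintype.card S * ∑ x, ∑ y, π x * P x y * (f x - f y) ^ 2 := by
  classical
  obtain ⟨x₀⟩ := hG.nonempty
  have h1 : ∑ x, π x * f x ^ 2 ≤ ∑ x, π x * (f x - f x₀) ^ 2 := by
    have : ∀ x, π x * (f x - f x₀) ^ 2 =
        π x * f x ^ 2 - 2 * f x₀ * (π x * f x) + π x * f x₀ ^ 2 := by intro x; ring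
    simp only [this, Finset.sum_add_distrib, Finset.sum_sub_distrib, ← Finset.mul_sum,
      ← Finset.sum_mul, hf, h.sum_eq_one]
    nlinarith [sq_nonneg (f x₀)]
  have h2 : ∀ x, a * b * (f x - f x₀) ^ 2 ≤
      Fintype.card S * ∑ x, ∑ y, π x * P x y * (f x - f y) ^ 2 := by
    intro x
    have := hG.sq_sub_le_card_mul_sum f x x₀
    calc a * b * (f x - f x₀) ^ 2
        ≤ a * b * (Fintype.card S * ∑ x, ∑ y, if G.Adj x y then (f x - f y) ^ 2 else 0) :=
          mul_le_mul_of_nonneg_left this (mul_nonneg ha hb)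
      _ = Fintype.card S *
          ∑ x, ∑ y, a * b * (if G.Adj x y then (f x - f y) ^ 2 else 0) := by
          simp only [← Finset.mul_sum]; ring
      _ ≤ _ := by
          refine mul_le_mul_of_nonneg_left (Finset.sum_le_sum fun u _ =>
            Finset.sum_le_sum fun v _ => ?_) (Nat.cast_nonneg _)
          split_ifs with huv
          · refine mul_le_mul_of_nonneg_right ?_ (sq_nonneg _)
            rw [mul_comm]
            exact mul_le_mul (hbπ u) (haP u v huv) ha (h.pos u).le
          · rw [mul_zero]
            exact mul_nonneg (mul_nonneg (h.pos u).le (h.nonneg u v)) (sq_nonneg _)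
  calc a * b * ∑ x, π x * f x ^ 2 ≤ a * b * ∑ x, π x * (f x - f x₀) ^ 2 :=
        mul_le_mul_of_nonneg_left h1 (mul_nonneg ha hb)
    _ = ∑ x, π x * (a * b * (f x - f x₀) ^ 2) := by
        rw [Finset.mul_sum]; exact Finset.sum_congr rfl fun _ _ => by ring
    _ ≤ ∑ x, π x * (Fintype.card S * ∑ x, ∑ y, π x * P x y * (f x - f y) ^ 2) :=
        Finset.sum_le_sum fun x _ => mul_le_mul_of_nonneg_left (h2 x) (h.pos x).le
    _ = _ := by rw [← Finset.sum_mul, h.sum_eq_one, one_mul]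

/-- Contraction of mean-zero functions in mean square. -/
theorem sum_mulVec_sq_le [DecidableEq S] (h : IsReversibleChain P π) {G : SimpleGraph S}
    (hG : G.Connected) {a b : ℝ} (ha : 0 ≤ a) (hb : 0 ≤ b) (haD : ∀ x, a ≤ P x x)
    (haP : ∀ x y, G.Adj x y → a ≤ P x y) (hbπ : ∀ x, b ≤ π x) {f : S → ℝ}
    (hf : ∑ x, π x * f x = 0) :
    ∑ x, π x * (P.mulVec f x) ^ 2 ≤
      (1 - a ^ 2 * b / Fintype.card S) * ∑ x, π x * f x ^ 2 := by
  obtain ⟨x₀⟩ := hG.nonempty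
  have hN : (0 : ℝ) < Fintype.card S := by exact_mod_cast Fintype.card_pos_iff.2 ⟨x₀⟩
  have h1 := h.holding_mul_dirichlet_le haD f
  have h2 := h.poincare hG ha hb haP hbπ hf
  set D := ∑ x, ∑ y, π x * P x y * (f x - f y) ^ 2
  set V := ∑ x, π x * f x ^ 2
  have h3 : a ^ 2 * b / Fintype.card S * V ≤ a * D := by
    rw [div_mul_eq_mul_div, div_le_iff₀ hN]
    calc a ^ 2 * b * V = a * (a * b * V) := by ring
      _ ≤ a * (Fintype.card S * D) := mul_le_mul_of_nonneg_left h2 ha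
      _ = _ := by ring
  linarith

/-- The density of `μ P` with respect to `π` is obtained by applying `P` to the density of `μ`. -/
theorem vecMul_div_sub_one (h : IsReversibleChain P π) (μ : S → ℝ) (y : S) :
    Matrix.vecMul μ P y / π y - 1 = P.mulVec (fun z => μ z / π z - 1) y := by
  have hy := (h.pos y).ne'
  simp only [Matrix.mulVec, Matrix.vecMul, dotProduct, mul_sub, Finset.sum_sub_distrib, mul_one,
    h.row_sum, Finset.sum_div]
  congr 1
  refine Finset.sum_congr rfl fun z _ => ?_
  have hz := (h.pos z).ne'
  have := h.balance y z
  field_simp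
  linear_combination (-μ z) * this

theorem sum_mul_div_sub_one (h : IsReversibleChain P π) {μ : S → ℝ} (hμ : ∑ x, μ x = 1) :
    ∑ x, π x * (μ x / π x - 1) = 0 := by
  have : ∀ x, π x * (μ x / π x - 1) = μ x - π x := fun x => by
    have := (h.pos x).ne'
    field_simp
  simp only [this, Finset.sum_sub_distrib, hμ, h.sum_eq_one, sub_self]

/-- The density of `π'` minus one is mean-zero and fixed by `P`, so strict contraction forces it to
vanish. -/
theorem eq_of_isStationaryDist [DecidableEq S] (h : IsReversibleChain P π) {G : SimpleGraph S}
    (hG : G.Connected) {a b : ℝ} (ha : 0 < a) (hb : 0 < b) (haD : ∀ x, a ≤ P x x)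
    (haP : ∀ x y, G.Adj x y → a ≤ P x y) (hbπ : ∀ x, b ≤ π x) {π' : S → ℝ}
    (h' : IsStationaryDist P π') : π' = π := by
  obtain ⟨x₀⟩ := hG.nonempty
  have hN : (0 : ℝ) < Fintype.card S := by exact_mod_cast Fintype.card_pos_iff.2 ⟨x₀⟩
  have hc := h.sum_mulVec_sq_le hG ha.le hb.le haD haP hbπ (h.sum_mul_div_sub_one h'.2.1)
  simp only [← h.vecMul_div_sub_one π', h'.2.2] at hc
  have hγ : 0 < a ^ 2 * b / Fintype.card S := by positivity
  have hnn : ∀ x ∈ Finset.univ, 0 ≤ π x * (π' x / π x - 1) ^ 2 := fun x _ =>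
    mul_nonneg (h.pos x).le (sq_nonneg _)
  have h0 : ∑ x, π x * (π' x / π x - 1) ^ 2 = 0 := by
    have := Finset.sum_nonneg hnn
    nlinarith
  ext x
  have hx := (Finset.sum_eq_zero_iff_of_nonneg hnn).1 h0 x (Finset.mem_univ x)
  have hp := (h.pos x).ne'
  have : π' x / π x - 1 = 0 := by simpa [hp] using hx
  field_simp at this
  linarith

/-- Cauchy–Schwarz bounds the L¹ distance by the root of the chi-square distance. -/
theorem tvDist_le_half (h : IsReversibleChain P π) {μ : S → ℝ}
    (hμ : ∑ x, π x * (μ x / π x - 1) ^ 2 ≤ 1) : tvDist μ π ≤ 1 / 2 := by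
  have h1 : ∑ x, |μ x - π x| = ∑ x, π x * |μ x / π x - 1| := by
    refine Finset.sum_congr rfl fun x _ => ?_
    have := (h.pos x).ne'
    rw [← abs_of_pos (h.pos x), ← abs_mul, abs_of_pos (h.pos x)]
    congr 1
    field_simp
  have h2 : (∑ x, π x * |μ x / π x - 1|) ^ 2 ≤
      (∑ x, π x) * ∑ x, π x * (μ x / π x - 1) ^ 2 :=
    Finset.sum_sq_le_sum_mul_sum_of_sq_le_mul _ (fun x _ => (h.pos x).le)
      (fun x _ => mul_nonneg (h.pos x).le (sq_nonneg _))
      (fun x _ => le_of_eq (by rw [mul_pow, sq_abs]; ring))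
  rw [h.sum_eq_one, one_mul] at h2
  have h3 : ∑ x, π x * |μ x / π x - 1| ≤ 1 := (sq_le_one_iff_abs_le_one _).1 (h2.trans hμ) |>
    (le_abs_self _).trans
  rw [tvDist, h1]
  linarith

/-- Iterates the contraction from a point mass, whose chi-square distance is `1 / π x - 1`. The
total mass is carried along because each step needs a mean-zero density. -/
theorem sum_pow_sq_le [DecidableEq S] (h : IsReversibleChain P π) {G : SimpleGraph S}
    (hG : G.Connected) {a b : ℝ} (ha : 0 ≤ a) (hb : 0 ≤ b) (haD : ∀ x, a ≤ P x x)
    (haP : ∀ x y, G.Adj x y → a ≤ P x y) (hbπ : ∀ x, b ≤ π x)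
    (hγ : a ^ 2 * b / Fintype.card S ≤ 1) (x : S) (t : ℕ) :
    ∑ y, (P ^ t) x y = 1 ∧ ∑ y, π y * ((P ^ t) x y / π y - 1) ^ 2 ≤
      (1 - a ^ 2 * b / Fintype.card S) ^ t * (1 / π x) := by
  induction t with
  | zero =>
    refine ⟨by simp [Matrix.one_apply], ?_⟩
    have hx := h.pos x
    have : ∀ y, π y * ((1 : Matrix S S ℝ) x y / π y - 1) ^ 2 =
        (if x = y then 1 / π y - 2 else 0) + π y := by
      intro y
      have hy := (h.pos y).ne'
      rw [Matrix.one_apply]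
      split_ifs
      · field_simp; ring
      · ring
    simp only [pow_zero, this, Finset.sum_add_distrib, h.sum_eq_one, Finset.sum_ite_eq,
      Finset.mem_univ, if_true, one_mul]
    linarith
  | succ t ih =>
    have hs : ∀ y, (P ^ (t + 1)) x y = Matrix.vecMul ((P ^ t) x) P y := fun y => by
      rw [pow_succ]; rfl
    constructor
    · simp only [hs, Matrix.vecMul, dotProduct]
      rw [Finset.sum_comm]
      simp only [← Finset.mul_sum, h.row_sum, mul_one, ih.1]
    · simp only [hs, h.vecMul_div_sub_one]
      refine (h.sum_mulVec_sq_le hG ha hb haD haP hbπ (h.sum_mul_div_sub_one ih.1)).trans ?_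
      rw [pow_succ' (1 - _), mul_assoc]
      exact mul_le_mul_of_nonneg_left ih.2 (sub_nonneg.2 hγ)

/-- Mixing bound for a reversible chain with holding and edge probabilities at least `a` and
stationary probabilities at least `b`. -/
theorem tvDist_pow_le_half [DecidableEq S] (h : IsReversibleChain P π) {G : SimpleGraph S}
    (hG : G.Connected) {a b : ℝ} (ha : 0 ≤ a) (hb : 0 < b) (haD : ∀ x, a ≤ P x x)
    (haP : ∀ x y, G.Adj x y → a ≤ P x y) (hbπ : ∀ x, b ≤ π x)
    (hγ : a ^ 2 * b / Fintype.card S ≤ 1) {t : ℕ}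
    (ht : Real.log (1 / b) ≤ a ^ 2 * b / Fintype.card S * t) (x : S) :
    tvDist ((P ^ t) x) π ≤ 1 / 2 := by
  refine h.tvDist_le_half ((h.sum_pow_sq_le hG ha hb.le haD haP hbπ hγ x t).2.trans ?_)
  set γ := a ^ 2 * b / Fintype.card S
  have h1 : (1 - γ) ^ t ≤ b := by
    calc (1 - γ) ^ t ≤ Real.exp (-γ) ^ t :=
          pow_le_pow_left₀ (by linarith) (Real.one_sub_le_exp_neg γ) t
      _ = Real.exp (-(γ * t)) := by rw [← Real.exp_nat_mul]; ring_nf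
      _ ≤ Real.exp (Real.log b) := by
          rw [one_div, Real.log_inv] at ht
          exact Real.exp_le_exp.2 (by linarith)
      _ = b := Real.exp_log hb
  rw [mul_one_div, div_le_one (h.pos x)]
  exact h1.trans (hbπ x)

end IsReversibleChain

end ReversibleChains

/-! ### CLIMB requests and their reversals. -/

namespace CacheState

variable {n m : ℕ}

/-- The position just above `j`, the first position being above itself. -/
def above (j : Fin m) : Fin m := ⟨j.val - 1, lt_of_le_of_lt (Nat.sub_le _ _) j.isLt⟩

theorem climbHit_apply (x : CacheState n m) (j k : Fin m) :
    x.climbHit j k = x (Equiv.swap (above j) j k) := rfl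

theorem climbHit_self (x : CacheState n m) (j : Fin m) : x.climbHit j j = x (above j) := by
  rw [climbHit_apply, Equiv.swap_apply_right]

theorem climbHit_above (x : CacheState n m) (j : Fin m) : x.climbHit j (above j) = x j := by
  rw [climbHit_apply, Equiv.swap_apply_left]

theorem climbHit_climbHit (x : CacheState n m) (j : Fin m) : (x.climbHit j).climbHit j = x := by
  ext k
  rw [climbHit_apply, climbHit_apply, Equiv.swap_apply_self]

theorem climbHit_of_val_eq_zero (x : CacheState n m) {j : Fin m} (hj : j.val = 0) :
    x.climbHit j = x := by
  have : above j = j := Fin.ext (by simp [above, hj])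
  ext k
  rw [climbHit_apply, this, Equiv.swap_self, Equiv.refl_apply]

theorem climbStep_apply (x : CacheState n m) (j : Fin m) : x.climbStep (x j) = x.climbHit j := by
  have h : x j ∈ Set.range x := ⟨j, rfl⟩
  rw [climbStep, dif_pos h]
  congr 1
  exact x.right_inv_of_invOfMemRange j

theorem climbStep_of_notMem (x : CacheState n m) {i : Fin n} (hi : i ∉ Set.range x) :
    x.climbStep i = x.climbMiss i hi := dif_neg hi

theorem climbMiss_apply (x : CacheState n m) {i : Fin n} (hi : i ∉ Set.range x) (k : Fin m) :
    x.climbMiss i hi k = if k.val + 1 = m then i else x k := rfl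

/-- The last position of a nonempty cache. -/
def lastPos (hm : 1 ≤ m) : Fin m := ⟨m - 1, by omega⟩

theorem val_add_one_eq_iff (hm : 1 ≤ m) (k : Fin m) : k.val + 1 = m ↔ k = lastPos hm := by
  rw [Fin.ext_iff, lastPos]
  dsimp only
  omega

theorem notMem_range_climbMiss (hm : 1 ≤ m) (x : CacheState n m) {i : Fin n}
    (hi : i ∉ Set.range x) : x (lastPos hm) ∉ Set.range (x.climbMiss i hi) := by
  rintro ⟨k, hk⟩
  rw [climbMiss_apply] at hk
  split_ifs at hk with h
  · exact hi ⟨_, hk.symm⟩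
  · exact h ((val_add_one_eq_iff hm k).2 (x.injective hk))

/-- The request that undoes the request `i` made in state `x`. -/
noncomputable def undo (hm : 1 ≤ m) (x : CacheState n m) (i : Fin n) : Fin n :=
  open Classical in
  if hi : i ∈ Set.range x then x (above (x.invOfMemRange ⟨i, hi⟩)) else x (lastPos hm)

theorem undo_apply (hm : 1 ≤ m) (x : CacheState n m) (j : Fin m) :
    x.undo hm (x j) = x (above j) := by
  have h : x j ∈ Set.range x := ⟨j, rfl⟩
  rw [undo, dif_pos h]
  congr 2
  exact x.right_inv_of_invOfMemRange j

theorem undo_of_notMem (hm : 1 ≤ m) (x : CacheState n m) {i : Fin n} (hi : i ∉ Set.range x) :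
    x.undo hm i = x (lastPos hm) := dif_neg hi

theorem climbStep_undo (hm : 1 ≤ m) (x : CacheState n m) (i : Fin n) :
    (x.climbStep i).climbStep (x.undo hm i) = x := by
  by_cases hi : i ∈ Set.range x
  · obtain ⟨j, rfl⟩ := hi
    rw [undo_apply, climbStep_apply, ← climbHit_self, climbStep_apply, climbHit_climbHit]
  · have h := notMem_range_climbMiss hm x hi
    rw [undo_of_notMem hm x hi, climbStep_of_notMem x hi, climbStep_of_notMem _ h]
    ext k
    rw [climbMiss_apply, climbMiss_apply]
    split_ifs with hk
    · rw [(val_add_one_eq_iff hm k).1 hk]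
    · rfl

/-- With `climbStep_undo`, this makes `undo` a bijection between the requests leading from `x` to
`y` and those leading back. -/
theorem undo_undo (hm : 1 ≤ m) (x : CacheState n m) (i : Fin n) :
    (x.climbStep i).undo hm (x.undo hm i) = i := by
  by_cases hi : i ∈ Set.range x
  · obtain ⟨j, rfl⟩ := hi
    rw [undo_apply, climbStep_apply, ← climbHit_self, undo_apply, climbHit_above]
  · have h := notMem_range_climbMiss hm x hi
    rw [undo_of_notMem hm x hi, climbStep_of_notMem x hi, undo_of_notMem hm _ h, climbMiss_apply,
      if_pos ((val_add_one_eq_iff hm _).2 rfl)]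

/-! ### Detailed balance. -/

/-- The unnormalized stationary weight of a cache state. -/
def weight (p : Fin n → ℝ) (x : CacheState n m) : ℝ := ∏ k : Fin m, p (x k) ^ (m - k.val)

/-- The exchange raises the exponent of the requested item by one and lowers that of its upper
neighbour by one. -/
theorem weight_climbHit (p : Fin n → ℝ) (x : CacheState n m) (j : Fin m) :
    weight p (x.climbHit j) * p (x (above j)) = weight p x * p (x j) := by
  rcases Nat.eq_zero_or_pos j.val with hj | hj
  · rw [climbHit_of_val_eq_zero x hj]
    congr 3
    exact Fin.ext (by simp [above, hj])
  have h1 : weight p (x.climbHit j) =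
      ∏ k, p (x k) ^ (m - (Equiv.swap (above j) j k).val) := by
    rw [weight, ← Equiv.prod_comp (Equiv.swap (above j) j)]
    simp only [climbHit_apply, Equiv.swap_apply_self]
  -- Writing the extra factor as a product over positions allows a comparison position by position.
  have h2 : ∀ l : Fin m, p (x l) = ∏ k, if k = l then p (x k) else 1 := fun l => by simp
  have hne : above j ≠ j := fun h => by
    have := congrArg Fin.val h
    simp only [above] at this
    omega
  rw [h1, weight, h2 (above j), h2 j, ← Finset.prod_mul_distrib, ← Finset.prod_mul_distrib]
  refine Finset.prod_congr rfl fun k _ => ?_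
  have hv : (above j).val = j.val - 1 := rfl
  by_cases ha : k = above j
  · subst ha
    rw [Equiv.swap_apply_left, if_pos rfl, if_neg hne, mul_one, ← pow_succ]
    congr 1
    omega
  · by_cases hb : k = j
    · subst hb
      rw [Equiv.swap_apply_right, if_neg ha, if_pos rfl, mul_one, ← pow_succ]
      congr 1
      omega
    · rw [Equiv.swap_apply_of_ne_of_ne ha hb, if_neg ha, if_neg hb]

theorem weight_climbMiss (hm : 1 ≤ m) (p : Fin n → ℝ) (x : CacheState n m) {i : Fin n}
    (hi : i ∉ Set.range x) :
    weight p (x.climbMiss i hi) * p (x (lastPos hm)) = weight p x * p i := by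
  have h2 : ∀ q : ℝ, q = ∏ k, if k = lastPos hm then q else 1 := fun q => by simp
  rw [weight, weight, h2 (p (x (lastPos hm))), h2 (p i), ← Finset.prod_mul_distrib,
    ← Finset.prod_mul_distrib]
  refine Finset.prod_congr rfl fun k _ => ?_
  by_cases hk : k = lastPos hm
  · have hk' := (val_add_one_eq_iff hm k).2 hk
    have : m - k.val = 1 := by omega
    rw [climbMiss_apply, if_pos hk', if_pos hk, if_pos hk, this, pow_one, pow_one, hk, mul_comm]
  · rw [climbMiss_apply, if_neg (mt (val_add_one_eq_iff hm k).1 hk), if_neg hk, if_neg hk]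

theorem weight_climbStep (hm : 1 ≤ m) (p : Fin n → ℝ) (x : CacheState n m) (i : Fin n) :
    weight p (x.climbStep i) * p (x.undo hm i) = weight p x * p i := by
  by_cases hi : i ∈ Set.range x
  · obtain ⟨j, rfl⟩ := hi
    rw [undo_apply, climbStep_apply, weight_climbHit]
  · rw [undo_of_notMem hm x hi, climbStep_of_notMem x hi, weight_climbMiss]

theorem weight_mul_climbMatrix (hm : 1 ≤ m) (p : Fin n → ℝ) (x y : CacheState n m) :
    weight p x * climbMatrix m p x y = weight p y * climbMatrix m p y x := by
  simp only [climbMatrix, ← Finset.sum_filter, Finset.mul_sum]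
  refine Finset.sum_nbij' (fun i => x.undo hm i) (fun i => y.undo hm i) ?_ ?_ ?_ ?_ ?_ <;>
    intro i hi <;> replace hi := (Finset.mem_filter.1 hi).2
  · subst hi
    simpa using climbStep_undo hm x i
  · subst hi
    simpa using climbStep_undo hm y i
  · subst hi
    exact undo_undo hm x i
  · subst hi
    exact undo_undo hm y i
  · subst hi
    exact (weight_climbStep hm p x i).symm

/-! ### Extremal weights by rearrangement. -/

/-- Every state is an initial segment of a permutation of the library. -/
theorem exists_perm_eq (hmn : m < n) (x : CacheState n m) :
    ∃ σ : Equiv.Perm (Fin n), ∀ k : Fin m, x k = σ ⟨k.val, k.isLt.trans hmn⟩ := by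
  obtain ⟨σ, hσ⟩ := Equiv.Perm.exists_extending_pair _ _ (Fin.castLE_injective hmn.le) x.injective
  exact ⟨σ, fun k => (hσ k).symm⟩

/-- Truncated subtraction gives exponent zero outside the cache, so weights become products over the
whole library, where permutations act. -/
theorem prod_pow_eq_prod_pow_sub (hmn : m < n) (q : Fin n → ℝ) :
    ∏ k : Fin m, q ⟨k.val, k.isLt.trans hmn⟩ ^ (m - k.val) = ∏ i : Fin n, q i ^ (m - i.val) := by
  refine Fintype.prod_of_injective (Fin.castLE hmn.le) (Fin.castLE_injective hmn.le) _ _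
    (fun i hi => ?_) fun k => rfl
  have : m ≤ i.val := by
    by_contra! h
    exact hi ⟨⟨i.val, h⟩, rfl⟩
  rw [Nat.sub_eq_zero_of_le this, pow_zero]

theorem climbTopWeight_eq (hmn : m < n) (p : Fin n → ℝ) :
    climbTopWeight hmn p = ∏ i : Fin n, p i ^ (m - i.val) :=
  prod_pow_eq_prod_pow_sub hmn p

theorem climbBottomWeight_eq (hmn : m < n) (p : Fin n → ℝ) :
    climbBottomWeight hmn p = ∏ i : Fin n, p (Fin.rev i) ^ (m - i.val) := by
  rw [← prod_pow_eq_prod_pow_sub hmn (fun i => p (Fin.rev i)), climbBottomWeight,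
    ← Equiv.prod_comp Fin.revPerm]
  refine Finset.prod_congr rfl fun k _ => ?_
  have h1 : (Fin.revPerm k).val = m - (k.val + 1) := by simp [Fin.val_rev]
  congr 1
  · congr 1
    ext
    rw [Fin.val_rev]
    dsimp only
    omega
  · omega

theorem prod_pow_le_prod_pow_of_log_sum {q r : Fin n → ℝ} (hq : ∀ i, 0 < q i) (hr : ∀ i, 0 < r i)
    (e : Fin n → ℕ) (h : ∑ i, (e i : ℝ) * Real.log (q i) ≤ ∑ i, (e i : ℝ) * Real.log (r i)) :
    ∏ i, q i ^ e i ≤ ∏ i, r i ^ e i := by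
  have key : ∀ {s : Fin n → ℝ}, (∀ i, 0 < s i) →
      ∏ i, s i ^ e i = Real.exp (∑ i, (e i : ℝ) * Real.log (s i)) := fun {s} hs => by
    rw [Real.exp_sum]
    refine Finset.prod_congr rfl fun i _ => ?_
    rw [Real.exp_nat_mul, Real.exp_log (hs i)]
  rw [key hq, key hr]
  exact Real.exp_le_exp.2 h

variable {p : Fin n → ℝ}

/-- Rearrangement inequality for logarithms: exponents and `log p` are both decreasing. -/
theorem weight_le_climbTopWeight (hmn : m < n) (hp : ∀ i, 0 < p i) (hanti : Antitone p)
    (x : CacheState n m) : weight p x ≤ climbTopWeight hmn p := by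
  obtain ⟨σ, hσ⟩ := exists_perm_eq hmn x
  have hx : weight p x = ∏ i : Fin n, p (σ i) ^ (m - i.val) := by
    rw [← prod_pow_eq_prod_pow_sub hmn (fun i => p (σ i)), weight]
    simp only [hσ]
  rw [hx, climbTopWeight_eq]
  refine prod_pow_le_prod_pow_of_log_sum (fun _ => hp _) hp _ ?_
  refine Monovary.sum_mul_comp_perm_le_sum_mul (σ := σ) (g := fun i => Real.log (p i))
    (Antitone.monovary (fun i j hij => ?_)
      fun i j hij => Real.log_le_log (hp j) (hanti hij))
  exact_mod_cast Nat.sub_le_sub_left hij m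

theorem climbBottomWeight_le_weight (hmn : m < n) (hp : ∀ i, 0 < p i) (hanti : Antitone p)
    (x : CacheState n m) : climbBottomWeight hmn p ≤ weight p x := by
  obtain ⟨σ, hσ⟩ := exists_perm_eq hmn x
  have hx : weight p x = ∏ i : Fin n, p (σ i) ^ (m - i.val) := by
    rw [← prod_pow_eq_prod_pow_sub hmn (fun i => p (σ i)), weight]
    simp only [hσ]
  rw [hx, climbBottomWeight_eq]
  refine prod_pow_le_prod_pow_of_log_sum (fun _ => hp _) (fun _ => hp _) _ ?_
  -- The reversal in the permutation cancels the one in `g`, leaving `log (p (σ i))`.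
  have h := Antivary.sum_mul_le_sum_mul_comp_perm (σ := σ.trans Fin.revPerm)
    (f := fun i : Fin n => ((m - i.val : ℕ) : ℝ)) (g := fun i => Real.log (p (Fin.rev i)))
    (Antitone.antivary (fun i j hij => by exact_mod_cast Nat.sub_le_sub_left hij m)
      fun i j hij => Real.log_le_log (hp _) (hanti (Fin.rev_le_rev.2 hij)))
  simpa using h

/-! ### Irreducibility. -/

/-- `y` can be reached from `x` by a sequence of requests. -/
abbrev Reaches (x y : CacheState n m) : Prop :=
  Relation.ReflTransGen (fun u v : CacheState n m => ∃ i, u.climbStep i = v) x y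

/-- An item below position `j` can be moved up to position `j` without changing the positions
above `j`. -/
theorem exists_reaches_apply_eq (x : CacheState n m) (j l : Fin m) (hjl : j ≤ l) :
    ∃ z, x.Reaches z ∧ z j = x l ∧ ∀ k < j, z k = x k := by
  obtain ⟨d, hd⟩ : ∃ d, l.val = j.val + d := ⟨l.val - j.val, by have : j.val ≤ l.val := hjl; omega⟩
  induction d generalizing x l with
  | zero => exact ⟨x, .refl, congrArg x (Fin.ext (by omega)), fun _ _ => rfl⟩
  | succ d ih =>
    have hv : (above l).val = l.val - 1 := rfl
    obtain ⟨z, hz, hzj, hzk⟩ := ih (x.climbHit l) (above l)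
      (Fin.le_def.2 (by omega)) (by omega)
    refine ⟨z, .head ⟨x l, climbStep_apply x l⟩ hz, hzj.trans (climbHit_above x l), fun k hk => ?_⟩
    have hk' : k.val < j.val := hk
    rw [hzk k hk, climbHit_apply, Equiv.swap_apply_of_ne_of_ne] <;>
      · intro h
        have := congrArg Fin.val h
        omega

/-- The target is built from the top down: the next item is brought in at the last position if
absent, then climbs to its place. -/
theorem exists_reaches_prefix (hm : 1 ≤ m) (x y : CacheState n m) (j : ℕ) (hj : j ≤ m) :
    ∃ z, x.Reaches z ∧ ∀ k : Fin m, k.val < j → z k = y k := by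
  induction j with
  | zero => exact ⟨x, .refl, fun k hk => absurd hk (Nat.not_lt_zero _)⟩
  | succ j ih =>
    obtain ⟨z, hz, hzy⟩ := ih (by omega)
    obtain ⟨u, hu, l, hl, huy⟩ : ∃ u, x.Reaches u ∧ ∃ l, u l = y ⟨j, hj⟩ ∧
        ∀ k : Fin m, k.val < j → u k = y k := by
      by_cases h : y ⟨j, hj⟩ ∈ Set.range z
      · obtain ⟨l, hl⟩ := h
        exact ⟨z, hz, l, hl, hzy⟩
      · refine ⟨z.climbMiss _ h, hz.tail ⟨_, climbStep_of_notMem z h⟩, lastPos hm, ?_, ?_⟩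
        · rw [climbMiss_apply, if_pos ((val_add_one_eq_iff hm _).2 rfl)]
        · intro k hk
          rw [climbMiss_apply, if_neg (by omega), hzy k hk]
    -- The positions above `j` already hold other items of `y`.
    have hjl : (⟨j, hj⟩ : Fin m) ≤ l := by
      by_contra! hlt
      have h1 : l.val < j := hlt
      have h2 := congrArg Fin.val (y.injective ((huy l h1).symm.trans hl))
      dsimp only at h2
      omega
    obtain ⟨v, hv, hvj, hvk⟩ := exists_reaches_apply_eq u ⟨j, hj⟩ l hjl
    refine ⟨v, hu.trans hv, fun k hk => ?_⟩
    rcases Nat.lt_succ_iff_lt_or_eq.1 hk with h | h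
    · rw [hvk k h, huy k h]
    · obtain rfl : k = ⟨j, hj⟩ := Fin.ext h
      rw [hvj, hl]

theorem reaches (hm : 1 ≤ m) (x y : CacheState n m) : x.Reaches y := by
  obtain ⟨z, hz, hzy⟩ := exists_reaches_prefix hm x y m le_rfl
  obtain rfl : z = y := DFunLike.ext _ _ fun k => hzy k k.isLt
  exact hz

/-- Two distinct states are adjacent if one request leads from one to the other. -/
def climbGraph (n m : ℕ) : SimpleGraph (CacheState n m) :=
  SimpleGraph.fromRel fun x y => ∃ i, x.climbStep i = y

theorem climbGraph_adj (hm : 1 ≤ m) {x y : CacheState n m} (h : (climbGraph n m).Adj x y) :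
    ∃ i, x.climbStep i = y := by
  rw [climbGraph, SimpleGraph.fromRel_adj] at h
  rcases h.2 with h | ⟨i, rfl⟩
  · exact h
  · exact ⟨_, climbStep_undo hm y i⟩

theorem climbGraph_connected (hm : 1 ≤ m) (hmn : m < n) : (climbGraph n m).Connected := by
  have : Nonempty (CacheState n m) := ⟨Fin.castLEEmb hmn.le⟩
  refine ⟨fun x y => ?_⟩
  induction reaches hm x y with
  | refl => exact .refl _
  | @tail b c _ hbc ih =>
    refine ih.trans ?_
    by_cases h : b = c
    · exact h ▸ .refl _
    · exact SimpleGraph.Adj.reachable ((SimpleGraph.fromRel_adj _ _ _).2 ⟨h, Or.inl hbc⟩)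

/-! ### Transition probabilities and the stationary law. -/

theorem le_climbMatrix (hp : ∀ i, 0 < p i) {x y : CacheState n m} {i : Fin n}
    (h : x.climbStep i = y) : p i ≤ climbMatrix m p x y := by
  have := Finset.single_le_sum (f := fun i => if x.climbStep i = y then p i else 0)
    (fun i _ => by split_ifs; exacts [(hp i).le, le_rfl]) (Finset.mem_univ i)
  rwa [if_pos h] at this

theorem climbMatrix_nonneg (hp : ∀ i, 0 < p i) (x y : CacheState n m) :
    0 ≤ climbMatrix m p x y :=
  Finset.sum_nonneg fun i _ => by split_ifs; exacts [(hp i).le, le_rfl]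

theorem climbMatrix_row_sum (hp1 : ∑ i, p i = 1) (x : CacheState n m) :
    ∑ y, climbMatrix m p x y = 1 := by
  simp only [climbMatrix]
  rw [Finset.sum_comm]
  simpa using hp1

theorem weight_pos (hp : ∀ i, 0 < p i) (x : CacheState n m) : 0 < weight p x :=
  Finset.prod_pos fun _ _ => pow_pos (hp _) _

theorem isReversibleChain_climbMatrix (hm : 1 ≤ m) (hmn : m < n) (hp : ∀ i, 0 < p i)
    (hp1 : ∑ i, p i = 1) :
    IsReversibleChain (climbMatrix m p) fun x => weight p x / ∑ y, weight (m := m) p y := by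
  have : Nonempty (CacheState n m) := ⟨Fin.castLEEmb hmn.le⟩
  have hZ : 0 < ∑ y, weight (m := m) p y :=
    Finset.sum_pos (fun x _ => weight_pos hp x) Finset.univ_nonempty
  refine ⟨climbMatrix_nonneg hp, climbMatrix_row_sum hp1, fun x => div_pos (weight_pos hp x) hZ,
    ?_, fun x y => ?_⟩
  · rw [← Finset.sum_div, div_self hZ.ne']
  · rw [div_mul_eq_mul_div, div_mul_eq_mul_div, weight_mul_climbMatrix hm]

theorem card_le (n m : ℕ) : (Fintype.card (CacheState n m) : ℝ) ≤ (n : ℝ) ^ m := by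
  have : Fintype.card (CacheState n m) ≤ n ^ m := by
    rw [Fintype.card_embedding_eq, Fintype.card_fin, Fintype.card_fin]
    exact Nat.descFactorial_le_pow n m
  exact_mod_cast this

theorem climbTopWeight_pos (hmn : m < n) (hp : ∀ i, 0 < p i) : 0 < climbTopWeight hmn p :=
  Finset.prod_pos fun _ _ => pow_pos (hp _) _

theorem climbBottomWeight_pos (hmn : m < n) (hp : ∀ i, 0 < p i) : 0 < climbBottomWeight hmn p :=
  Finset.prod_pos fun _ _ => pow_pos (hp _) _

end CacheState

/-! ### The mixing time bound. -/

theorem mainTheorem7 :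
    ∃ C : ℝ, 0 < C ∧
      ∀ (n m : ℕ) (_hm : 1 ≤ m) (hmn : m < n) (p : Fin n → ℝ),
        (∀ i, 0 < p i) → Antitone p → ∑ i, p i = 1 →
        ∃ π : CacheState n m → ℝ,
          IsStationaryDist (climbMatrix m p) π ∧
          (∀ π' : CacheState n m → ℝ, IsStationaryDist (climbMatrix m p) π' → π' = π) ∧
          ∃ t : ℕ, IsMixingTime (climbMatrix m p) π (1 / 2) t ∧
            (t : ℝ) ≤ C *
              ((n : ℝ) ^ (2 * m) * climbTopWeight hmn p ^ 6 /
                (p ⟨n - 1, by omega⟩ ^ 2 * climbBottomWeight hmn p ^ 6) *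
                Real.log ((n : ℝ) ^ m * climbTopWeight hmn p / climbBottomWeight hmn p)) := by
  refine ⟨3, by norm_num, fun n m hm hmn p hp hanti hp1 => ?_⟩
  classical
  set a := p ⟨n - 1, by omega⟩ with ha_def
  set T := climbTopWeight hmn p
  set B := climbBottomWeight hmn p
  have hne : Nonempty (CacheState n m) := ⟨Fin.castLEEmb hmn.le⟩
  have hrev := CacheState.isReversibleChain_climbMatrix hm hmn hp hp1
  have hG := CacheState.climbGraph_connected hm hmn
  have ha : 0 < a := hp _
  have ha1 : a ≤ 1 := hp1 ▸ Finset.single_le_sum (fun i _ => (hp i).le) (Finset.mem_univ _)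
  have hap : ∀ i, a ≤ p i := fun i => hanti (Fin.le_def.2 (by dsimp only; omega))
  have hT : 0 < T := CacheState.climbTopWeight_pos hmn hp
  have hB : 0 < B := CacheState.climbBottomWeight_pos hmn hp
  have hBT : B ≤ T := by
    obtain ⟨x⟩ := hne
    exact (CacheState.climbBottomWeight_le_weight hmn hp hanti x).trans
      (CacheState.weight_le_climbTopWeight hmn hp hanti x)
  have hNnat : 2 ≤ n ^ m := calc
    2 ≤ n := by omega
    _ ≤ n ^ m := Nat.le_self_pow (by omega) n
  have hN2 : (2 : ℝ) ≤ (n : ℝ) ^ m := by exact_mod_cast hNnat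
  set N : ℝ := (n : ℝ) ^ m with hN_def
  have hN : 0 < N := by linarith
  have hcard := CacheState.card_le n m
  have hcard0 : (0 : ℝ) < Fintype.card (CacheState n m) := by exact_mod_cast Fintype.card_pos
  set b := B / (N * T) with hb_def
  have hb : 0 < b := by positivity
  have hbπ : ∀ x : CacheState n m, b ≤ CacheState.weight p x / ∑ y, CacheState.weight (m := m) p y := by
    intro x
    refine div_le_div₀ (CacheState.weight_pos hp x).le
      (CacheState.climbBottomWeight_le_weight hmn hp hanti x)
      (Finset.sum_pos (fun x _ => CacheState.weight_pos hp x) Finset.univ_nonempty) ?_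
    calc ∑ y, CacheState.weight (m := m) p y ≤ ∑ _y : CacheState n m, T :=
          Finset.sum_le_sum fun y _ => CacheState.weight_le_climbTopWeight hmn hp hanti y
      _ = Fintype.card (CacheState n m) * T := by simp
      _ ≤ N * T := mul_le_mul_of_nonneg_right hcard hT.le
  have haD : ∀ x, a ≤ climbMatrix m p x x := fun x =>
    (hap _).trans (CacheState.le_climbMatrix hp (i := x ⟨0, hm⟩)
      ((x.climbStep_apply _).trans (x.climbHit_of_val_eq_zero rfl)))
  have haP : ∀ x y, (CacheState.climbGraph n m).Adj x y → a ≤ climbMatrix m p x y := by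
    intro x y hxy
    obtain ⟨i, hi⟩ := CacheState.climbGraph_adj hm hxy
    exact (hap i).trans (CacheState.le_climbMatrix hp hi)
  refine ⟨_, hrev.isStationaryDist,
    fun π' h' => hrev.eq_of_isStationaryDist hG ha hb haD haP hbπ h', ?_⟩
  set K := N * T / B with hK_def
  have hbK : 1 / b = K := by rw [hb_def, one_div_div]
  have hK2 : 2 ≤ K := by
    rw [hK_def, le_div_iff₀ hB]
    exact mul_le_mul hN2 hBT hB.le hN.le
  have hlog : 1 / 2 ≤ Real.log K := by
    have := Real.log_le_log (by norm_num) hK2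
    linarith [Real.log_two_gt_d9]
  set γ := a ^ 2 * b / Fintype.card (CacheState n m) with hγ_def
  have hγ : 0 < γ := by positivity
  have hb1 : b ≤ 1 := by
    rw [← one_div_one_div b, hbK, div_le_one (by linarith)]
    linarith
  have hγ1 : γ ≤ 1 := by
    rw [hγ_def, div_le_one hcard0]
    have h1 : (1 : ℝ) ≤ Fintype.card (CacheState n m) := by
      exact_mod_cast Nat.one_le_iff_ne_zero.2 Fintype.card_ne_zero
    exact (mul_le_one₀ (pow_le_one₀ ha.le ha1) hb.le hb1).trans h1
  have hmix : ∀ x, tvDist ((climbMatrix m p ^ ⌈Real.log K / γ⌉₊) x) _ ≤ 1 / 2 :=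
    hrev.tvDist_pow_le_half hG ha.le hb haD haP hbπ hγ1 (by
      rw [hbK, mul_comm, ← div_le_iff₀ hγ]
      exact Nat.le_ceil _)
  have hex : ∃ s : ℕ, ∀ x, tvDist ((climbMatrix m p ^ s) x)
      (fun x => CacheState.weight p x / ∑ y, CacheState.weight (m := m) p y) ≤ 1 / 2 := ⟨_, hmix⟩
  refine ⟨Nat.find hex, ⟨Nat.find_spec hex, fun s hs => Nat.find_min' hex hs⟩, ?_⟩
  have hinv : 1 / γ ≤ (n : ℝ) ^ (2 * m) * T ^ 6 / (a ^ 2 * B ^ 6) := by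
    -- The argument yields the first power of `T / B`; the sixth is only weaker, since `T / B ≥ 1`.
    have hR : T / B ≤ (T / B) ^ 6 := le_self_pow₀ ((one_le_div hB).2 hBT) (by norm_num)
    calc 1 / γ = Fintype.card (CacheState n m) * (N * (T / B) / a ^ 2) := by
          rw [hγ_def, hb_def]; field_simp
      _ ≤ N * (N * (T / B) ^ 6 / a ^ 2) := by gcongr
      _ = _ := by rw [mul_comm 2 m, pow_mul, ← hN_def]; field_simp
  have hceil := (Nat.ceil_lt_add_one (a := Real.log K / γ) (by positivity)).le
  have hfind : ((Nat.find hex : ℕ) : ℝ) ≤ (⌈Real.log K / γ⌉₊ : ℝ) := by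
    exact_mod_cast Nat.find_min' hex hmix
  -- This absorbs the `+ 1` of the ceiling, `L + 1 ≤ 3 * L`, and is the source of the constant `3`.
  have h1 : 1 / 2 ≤ Real.log K / γ := hlog.trans (by
    rw [le_div_iff₀ hγ]
    exact mul_le_of_le_one_right (by linarith) hγ1)
  calc ((Nat.find hex : ℕ) : ℝ) ≤ 3 * (1 / γ * Real.log K) := by
        rw [one_div_mul_eq_div]; linarith
    _ ≤ _ := by gcongr
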